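/- For integers $r\ge 1$, $n\ge 0$ let $\rho_1^{(r)}(n)=(2rn)!$ and $\rho_2^{(r)}(n)=[(rn)!]^2$. For $x>0$ put $$W_1^{(r)}(x)=\frac{1}{2r\,x^{(2r-1)/(2r)}}\,e^{-x^{1/(2r)}},\qquad W_2^{(r)}(x)=\frac{2}{r\,x^{(r-1)/r}}\,K_0\!\left(2x^{1/(2r)}\right),$$ where $K_0(z)=\int_0^\infty e^{-z\cosh t}\,dt$ $(z>0)$ is the modified Bessel function of the second kind of order $0$. A solution of the Stieltjes moment problem for a sequence $(\rho(n))_{n\ge 0}$ is a positive continuous function $W$ on $(0,\infty)$ with $\int_0^\infty x^nW(x)\,dx=\rho(n)$ for all $n\ge 0$ (absolutely convergent integrals); the problem is called determinate if exactly one positive Borel measure on $[0,\infty)$ has the moments $\rho(n)$, and indeterminate if at least two such measures exist. Let $i\in\{1,2\}$. Then: (a) For every $r\ge 1$, $W_i^{(r)}$ is a solution of the Stieltjes moment problem for $\rho_i^{(r)}$. (b) For $r=1$, $\sum_{n\ge 1}[\rho_i^{(1)}(n)]^{-1/(2n)}=\infty$, the moment problem for $\rho_i^{(1)}$ is determinate,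 and $W_i^{(1)}$ is its only solution. (c) For every integer $r>1$, $\sum_{n\ge 1}[\rho_i^{(r)}(n)]^{-1/(2n)}<\infty$; the Krein integral $\int_0^\infty\frac{-\ln W_i^{(r)}(x^2)}{1+x^2}\,dx$ converges absolutely; the function $y\mapsto-\ln W_i^{(r)}(e^y)$ is convex on $\mathbb{R}$; the moment problem for $\rho_i^{(r)}$ is indeterminate; and it has a solution different from $W_i^{(r)}$. -/

import Mathlib

open MeasureTheory Set
open scoped Nat

noncomputable section

/-- A positive continuous function on `(0, ∞)` with `∫₀^∞ xⁿ W(x) dx = ρ n` for all `n`,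
the integrals being absolutely convergent. -/
structure IsStieltjesSolution (ρ : ℕ → ℝ) (W : ℝ → ℝ) : Prop where
  continuousOn : ContinuousOn W (Ioi 0)
  pos : ∀ x : ℝ, 0 < x → 0 < W x
  integrable : ∀ n : ℕ, IntegrableOn (fun x : ℝ => x ^ n * W x) (Ioi 0)
  moment : ∀ n : ℕ, ∫ x in Ioi (0 : ℝ), x ^ n * W x = ρ n

/-- A (positive Borel) measure concentrated on `[0, ∞)` with moments `ρ n`. -/
structure IsStieltjesMeasure (ρ : ℕ → ℝ) (μ : Measure ℝ) : Prop where
  support : μ (Iio 0) = 0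
  integrable : ∀ n : ℕ, Integrable (fun x : ℝ => x ^ n) μ
  moment : ∀ n : ℕ, ∫ x, x ^ n ∂μ = ρ n

/-- The Stieltjes moment problem for `ρ` has exactly one solution. -/
def StieltjesDeterminate (ρ : ℕ → ℝ) : Prop :=
  ∃! μ : Measure ℝ, IsStieltjesMeasure ρ μ

/-- The Stieltjes moment problem for `ρ` has at least two solutions. -/
def StieltjesIndeterminate (ρ : ℕ → ℝ) : Prop :=
  ∃ μ ν : Measure ℝ, IsStieltjesMeasure ρ μ ∧ IsStieltjesMeasure ρ ν ∧ μ ≠ ν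

/-- The moment sequence `(2rn)!`. -/
def moments₁ (r n : ℕ) : ℝ := ((2 * r * n)! : ℕ)

/-- The moment sequence `[(rn)!]²`. -/
def moments₂ (r n : ℕ) : ℝ := (((r * n)! : ℕ) : ℝ) ^ 2

/-- The modified Bessel function of the second kind of order `0`, for `z > 0`. -/
def besselK₀ (z : ℝ) : ℝ := ∫ t in Ioi (0 : ℝ), Real.exp (-(z * Real.cosh t))

/-- The principal solution for the moments `(2rn)!`. -/
def principal₁ (r : ℕ) (x : ℝ) : ℝ :=
  1 / (2 * r * x ^ ((2 * r - 1 : ℝ) / (2 * r))) * Real.exp (-(x ^ (1 / (2 * r : ℝ))))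

/-- The principal solution for the moments `[(rn)!]²`. -/
def principal₂ (r : ℕ) (x : ℝ) : ℝ :=
  2 / (r * x ^ ((r - 1 : ℝ) / r)) * besselK₀ (2 * x ^ (1 / (2 * r : ℝ)))

/-- The term of index `n + 1` of the Carleman series `∑_{n ≥ 1} ρ(n)^{-1/(2n)}`. -/
def carlemanTerm (ρ : ℕ → ℝ) (n : ℕ) : ℝ :=
  (ρ (n + 1)) ^ (-(1 / (2 * ((n : ℝ) + 1))))

/-- Convergence of the Krein integral `∫₀^∞ -ln W(x²) / (1 + x²) dx`. -/
def KreinIntegralConverges (W : ℝ → ℝ) : Prop :=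
  IntegrableOn (fun x : ℝ => -Real.log (W (x ^ 2)) / (1 + x ^ 2)) (Ioi 0)

end

/-!
Under the substitution `x = s ^ (2r)` the two densities become `exp (-s)` and `4 * s * K₀ (2 * s)`
on `(0, ∞)`, and the moment of order `n` becomes the moment of order `2rn` in `s`. The first is the
Gamma integral. For the second, exchanging the order of integration leaves
`∫₀^∞ cosh⁻²ᴹ⁻² t dt`, which a reduction formula evaluates (`integral_pow_mul_besselK₀`).

*Determinacy.* For `r = 1` both moment sequences satisfy `ρ n ≤ (2n)!`. The image of a solution
under `x ↦ ±√x` has moment generating function `2 * ∑ ρ n * t ^ (2n) / (2n)!`, possibly infinite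
and finite for `|t| < 1`. The moments therefore determine the moment generating function, hence by
analytic continuation the characteristic function, hence the measure
(`IsStieltjesMeasure.eq_of_le_factorial`).

*Indeterminacy.* Let `m = 2r > 2` and let `p` have argument `π / m`, so that `p ^ m` is real. Since
`∫₀^∞ s ^ j * exp (-p * s) ds = j! / p ^ (j + 1)`, the function
`s ^ k * Im (p ^ (k + 1) * exp (-p * s))` is orthogonal to all `s ^ (m * n)`
(`exists_vanishing_moments`). As `re p > 0` is arbitrary, a small multiple of it with `k = 0` can be
added to `exp (-s)`, and one with `k = 1` to `4 * s * K₀ (2 * s)`, because `K₀ z ≥ exp (-2 * z)`;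
positivity and the moments are preserved.

*Convexity.* For the Bessel density this amounts to `z ↦ -z * K₀' z / K₀ z` being increasing. By
Bessel's equation its derivative is `z * (K₀'² - K₀²) / K₀²`, and `K₀ ≤ -K₀'`
(`monotoneOn_mul_besselCosh_div`).

The Carleman series are compared with `∑ 1 / n` and `∑ 1 / n ^ 2`, and the Krein integrals with
that of `(x ^ (1 / 2) + x ^ (-1 / 2)) / (1 + x ^ 2)`.
-/

/-! ### Densities, measures and determinacy -/

/-- The measure on `ℝ` with density `W` on `(0, ∞)` and no mass elsewhere. -/
noncomputable def densityMeasure (W : ℝ → ℝ) : Measure ℝ :=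
  (volume.restrict (Ioi 0)).withDensity fun x => ENNReal.ofReal (W x)

namespace IsStieltjesSolution

variable {ρ : ℕ → ℝ} {W V : ℝ → ℝ}

theorem aemeasurable (h : IsStieltjesSolution ρ W) :
    AEMeasurable (fun x => ENNReal.ofReal (W x)) (volume.restrict (Ioi 0)) :=
  (h.continuousOn.aemeasurable measurableSet_Ioi).ennreal_ofReal

theorem isStieltjesMeasure (h : IsStieltjesSolution ρ W) :
    IsStieltjesMeasure ρ (densityMeasure W) := by
  have htop : ∀ᵐ x ∂(volume.restrict (Ioi (0 : ℝ))), ENNReal.ofReal (W x) < ⊤ :=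
    ae_of_all _ fun x => ENNReal.ofReal_lt_top
  have hcongr : ∀ n : ℕ, ∀ x ∈ Ioi (0 : ℝ),
      x ^ n * W x = (ENNReal.ofReal (W x)).toReal • x ^ n := by
    intro n x hx
    rw [ENNReal.toReal_ofReal (h.pos x hx).le, smul_eq_mul, mul_comm]
  refine ⟨?_, fun n => ?_, fun n => ?_⟩
  · apply withDensity_absolutelyContinuous
    rw [Measure.restrict_apply measurableSet_Iio]
    have : Iio (0 : ℝ) ∩ Ioi 0 = ∅ := by
      ext x
      simp only [mem_inter_iff, mem_Iio, mem_Ioi, mem_empty_iff_false, iff_false, not_and, not_lt]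
      exact fun hx => hx.le
    rw [this, measure_empty]
  · rw [densityMeasure, integrable_withDensity_iff_integrable_smul₀' h.aemeasurable htop]
    exact (integrableOn_congr_fun (hcongr n) measurableSet_Ioi).1 (h.integrable n)
  · rw [densityMeasure, integral_withDensity_eq_integral_toReal_smul₀ h.aemeasurable htop,
      ← setIntegral_congr_fun measurableSet_Ioi (hcongr n)]
    exact h.moment n

/-- Two solutions that define the same measure agree everywhere on `(0, ∞)`, by continuity. -/
theorem eqOn_of_densityMeasure_eq (hW : IsStieltjesSolution ρ W) (hV : IsStieltjesSolution ρ V)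
    (h : densityMeasure W = densityMeasure V) : EqOn W V (Ioi 0) := by
  have hfin : ∫⁻ x in Ioi (0 : ℝ), ENNReal.ofReal (W x) ≠ ⊤ := by
    have := (hW.integrable 0).lintegral_lt_top
    simpa using this.ne
  have hae := (withDensity_eq_iff hW.aemeasurable hV.aemeasurable hfin).1 h
  refine Measure.eqOn_open_of_ae_eq (μ := volume) ?_ isOpen_Ioi hW.continuousOn hV.continuousOn
  filter_upwards [hae, ae_restrict_mem measurableSet_Ioi] with x hx hx0
  exact (ENNReal.ofReal_eq_ofReal_iff (hW.pos x hx0).le (hV.pos x hx0).le).1 hx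

end IsStieltjesSolution

/-- The symmetrisation of a measure under the substitution `x = y²`, of total mass twice that of
`μ`: the sum of the images of `μ` under `√` and `-√`. -/
noncomputable def symmetrization (μ : Measure ℝ) : Measure ℝ :=
  μ.map Real.sqrt + μ.map fun x => -Real.sqrt x

/-- The symmetrisation of a measure on `[0, ∞)` determines that measure. -/
theorem map_sq_symmetrization {μ : Measure ℝ} (hμ : μ (Iio 0) = 0) :
    (symmetrization μ).map (fun y => y ^ 2) = (2 : ENNReal) • μ := by
  have hsq : Measurable fun y : ℝ => y ^ 2 := by fun_prop
  have hs : Measurable Real.sqrt := Real.continuous_sqrt.measurable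
  have hns : Measurable fun x => -Real.sqrt x := hs.neg
  have hae : ∀ᵐ x ∂μ, 0 ≤ x := by
    simpa only [ae_iff, not_le] using! hμ
  have h1 : (fun y : ℝ => y ^ 2) ∘ Real.sqrt =ᵐ[μ] id := by
    filter_upwards [hae] with x hx
    simp [Real.sq_sqrt hx]
  have h2 : ((fun y : ℝ => y ^ 2) ∘ fun x => -Real.sqrt x) =ᵐ[μ] id := by
    filter_upwards [hae] with x hx
    simp [Real.sq_sqrt hx]
  rw [symmetrization, Measure.map_add _ _ hsq, Measure.map_map hsq hs, Measure.map_map hsq hns,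
    Measure.map_congr h1, Measure.map_congr h2, Measure.map_id, two_smul]

/-- By monotone convergence, the moments determine the (possibly infinite) exponential integrals
of the symmetrisation. -/
theorem IsStieltjesMeasure.lintegral_exp_symmetrization {ρ : ℕ → ℝ} {μ : Measure ℝ}
    (h : IsStieltjesMeasure ρ μ) (t : ℝ) :
    ∫⁻ y, ENNReal.ofReal (Real.exp (t * y)) ∂(symmetrization μ) =
      ∑' n : ℕ, ENNReal.ofReal (2 * (t ^ (2 * n) / (2 * n)!) * ρ n) := by
  have hs : Measurable Real.sqrt := Real.continuous_sqrt.measurable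
  have hm : Measurable fun y => ENNReal.ofReal (Real.exp (t * y)) := by fun_prop
  have hae : ∀ᵐ x ∂μ, 0 ≤ x := by
    simpa only [ae_iff, not_le] using! h.support
  have hpt : ∀ᵐ x ∂μ, ENNReal.ofReal (Real.exp (t * Real.sqrt x)) +
      ENNReal.ofReal (Real.exp (t * -Real.sqrt x)) =
      ∑' n : ℕ, ENNReal.ofReal (2 * (t ^ (2 * n) / (2 * n)!) * x ^ n) := by
    filter_upwards [hae] with x hx
    rw [← ENNReal.ofReal_add (Real.exp_pos _).le (Real.exp_pos _).le]
    have hsum := (Real.hasSum_cosh (t * Real.sqrt x)).mul_left 2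
    have hterm : ∀ n : ℕ, 2 * ((t * Real.sqrt x) ^ (2 * n) / ((2 * n)! : ℕ)) =
        2 * (t ^ (2 * n) / (2 * n)!) * x ^ n := by
      intro n
      rw [mul_pow, pow_mul (Real.sqrt x), Real.sq_sqrt hx]
      ring
    simp only [hterm] at hsum
    rw [← ENNReal.ofReal_tsum_of_nonneg _ hsum.summable, hsum.tsum_eq, Real.cosh_eq]
    · congr 1
      rw [mul_neg]
      ring
    · intro n
      have : 0 ≤ t ^ (2 * n) := by rw [pow_mul]; positivity
      positivity
  have hns : Measurable fun x => -Real.sqrt x := hs.neg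
  rw [symmetrization, lintegral_add_measure, lintegral_map hm hs, lintegral_map hm hns,
    ← lintegral_add_left
      (show Measurable fun x => ENNReal.ofReal (Real.exp (t * Real.sqrt x)) by fun_prop),
    lintegral_congr_ae hpt,
    lintegral_tsum fun n => by fun_prop]
  congr 1
  ext n
  rw [← ofReal_integral_eq_lintegral_ofReal ((h.integrable n).const_mul _), integral_const_mul,
    h.moment n]
  filter_upwards [hae] with x hx
  have : 0 ≤ t ^ (2 * n) := by rw [pow_mul]; positivity
  simp only [Pi.zero_apply]
  positivity

theorem IsStieltjesMeasure.isFiniteMeasure {ρ : ℕ → ℝ} {μ : Measure ℝ}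
    (h : IsStieltjesMeasure ρ μ) : IsFiniteMeasure μ := by
  have := h.integrable 0
  simp only [pow_zero] at this
  exact (integrable_const_iff_isFiniteMeasure one_ne_zero).1 this

/-- Moments `ρ n ≤ (2n)!` determine a measure on `[0, ∞)`: its symmetrisation has finite
exponential moments near `0`, so it is determined by its moment generating function. -/
theorem IsStieltjesMeasure.eq_of_le_factorial {ρ : ℕ → ℝ} (hρ : ∀ n, ρ n ≤ ((2 * n)! : ℕ))
    {μ ν : Measure ℝ} (hμ : IsStieltjesMeasure ρ μ) (hν : IsStieltjesMeasure ρ ν) : μ = ν := by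
  have := hμ.isFiniteMeasure
  have := hν.isFiniteMeasure
  have : IsFiniteMeasure (symmetrization μ) := by unfold symmetrization; infer_instance
  have : IsFiniteMeasure (symmetrization ν) := by unfold symmetrization; infer_instance
  have hmgf : ∀ {κ : Measure ℝ}, IsStieltjesMeasure ρ κ → ∀ t,
      ProbabilityTheory.mgf id (symmetrization κ) t =
        (∑' n : ℕ, ENNReal.ofReal (2 * (t ^ (2 * n) / (2 * n)!) * ρ n)).toReal := by
    intro κ hκ t
    rw [ProbabilityTheory.mgf, integral_eq_lintegral_of_nonneg_ae
      (ae_of_all _ fun y => (Real.exp_pos _).le) (by fun_prop),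
      ← hκ.lintegral_exp_symmetrization t]
    rfl
  have heq : ProbabilityTheory.mgf id (symmetrization μ) =
      ProbabilityTheory.mgf id (symmetrization ν) := by
    ext t
    rw [hmgf hμ, hmgf hν]
  have hint : (0 : ℝ) ∈
      interior (ProbabilityTheory.integrableExpSet id (symmetrization μ)) := by
    refine mem_interior.2 ⟨Ioo (-1) 1, fun t ht => ?_, isOpen_Ioo, by norm_num⟩
    refine ⟨by fun_prop, ?_⟩
    rw [hasFiniteIntegral_iff_ofReal (ae_of_all _ fun y => (Real.exp_pos _).le)]
    simp only [id]
    rw [hμ.lintegral_exp_symmetrization t]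
    have ht2 : t ^ 2 < 1 := by
      rw [sq_lt_one_iff_abs_lt_one, abs_lt]
      exact ht
    have hsum : Summable fun n : ℕ => 2 * (t ^ 2) ^ n :=
      (summable_geometric_of_lt_one (sq_nonneg t) ht2).mul_left 2
    refine lt_of_le_of_lt (ENNReal.tsum_le_tsum fun n => ENNReal.ofReal_le_ofReal ?_)
      hsum.tsum_ofReal_lt_top
    have h0 : 0 ≤ (t ^ 2) ^ n := by positivity
    have hf : (0 : ℝ) < ((2 * n)! : ℕ) := by positivity
    calc 2 * (t ^ (2 * n) / (2 * n)!) * ρ n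
        ≤ 2 * (t ^ (2 * n) / (2 * n)!) * ((2 * n)! : ℕ) := by
          refine mul_le_mul_of_nonneg_left (hρ n) ?_
          rw [pow_mul]
          positivity
      _ = 2 * (t ^ 2) ^ n := by
          rw [pow_mul]
          field_simp
  have hzero : symmetrization μ = 0 ↔ symmetrization ν = 0 := by
    have h0 := congrFun heq 0
    simp only [ProbabilityTheory.mgf_zero'] at h0
    rw [← Measure.measure_univ_eq_zero, ← Measure.measure_univ_eq_zero (μ := symmetrization ν),
      ← measureReal_eq_zero_iff, ← measureReal_eq_zero_iff, h0]
  have hsym : symmetrization μ = symmetrization ν := by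
    refine Measure.ext_of_charFun ?_
    ext t
    rw [← ProbabilityTheory.complexMGF_id_mul_I, ← ProbabilityTheory.complexMGF_id_mul_I]
    exact ProbabilityTheory.eqOn_complexMGF_of_mgf' heq hzero (by simpa using hint)
  have h2 : (2 : ENNReal) • μ = (2 : ENNReal) • ν := by
    rw [← map_sq_symmetrization hμ.support, hsym, map_sq_symmetrization hν.support]
  ext s hs
  have hs2 := congrArg (fun κ : Measure ℝ => κ s) h2
  simpa [ENNReal.mul_right_inj] using hs2

theorem IsStieltjesSolution.determinate_of_le_factorial {ρ : ℕ → ℝ} {W : ℝ → ℝ}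
    (h : IsStieltjesSolution ρ W) (hρ : ∀ n, ρ n ≤ ((2 * n)! : ℕ)) : StieltjesDeterminate ρ :=
  ⟨densityMeasure W, h.isStieltjesMeasure,
    fun _ hμ => hμ.eq_of_le_factorial hρ h.isStieltjesMeasure⟩

theorem IsStieltjesSolution.eqOn_of_le_factorial {ρ : ℕ → ℝ} {W V : ℝ → ℝ}
    (hW : IsStieltjesSolution ρ W) (hV : IsStieltjesSolution ρ V)
    (hρ : ∀ n, ρ n ≤ ((2 * n)! : ℕ)) : EqOn W V (Ioi 0) :=
  hW.eqOn_of_densityMeasure_eq hV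
    (hW.isStieltjesMeasure.eq_of_le_factorial hρ hV.isStieltjesMeasure)

theorem IsStieltjesSolution.indeterminate {ρ : ℕ → ℝ} {W V : ℝ → ℝ}
    (hW : IsStieltjesSolution ρ W) (hV : IsStieltjesSolution ρ V)
    (h : ∃ x, 0 < x ∧ V x ≠ W x) : StieltjesIndeterminate ρ := by
  obtain ⟨x, hx, hne⟩ := h
  exact ⟨densityMeasure V, densityMeasure W, hV.isStieltjesMeasure, hW.isStieltjesMeasure,
    fun heq => hne (hV.eqOn_of_densityMeasure_eq hW heq hx)⟩

/-! ### Power substitutions -/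

/-- The density on `(0, ∞)` of the image under `s ↦ s ^ m` of the measure with density `f`. -/
noncomputable def powDensity (m : ℕ) (f : ℝ → ℝ) (x : ℝ) : ℝ :=
  1 / (m * x ^ ((m - 1 : ℝ) / m)) * f (x ^ (1 / (m : ℝ)))

theorem smul_pow_mul_powDensity {m : ℕ} (hm : 0 < m) (f : ℝ → ℝ) (n : ℕ) {s : ℝ} (hs : 0 < s) :
    ((m : ℝ) * s ^ ((m : ℝ) - 1)) • ((s ^ (m : ℝ)) ^ n * powDensity m f (s ^ (m : ℝ))) =
      s ^ (m * n) * f s := by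
  have hm0 : (m : ℝ) ≠ 0 := by positivity
  have h1 : (s ^ (m : ℝ)) ^ ((m - 1 : ℝ) / m) = s ^ ((m : ℝ) - 1) := by
    rw [← Real.rpow_mul hs.le]
    congr 1
    field_simp
  have h2 : (s ^ (m : ℝ)) ^ (1 / (m : ℝ)) = s := by
    rw [← Real.rpow_mul hs.le, mul_one_div_cancel hm0, Real.rpow_one]
  have h3 : 0 < s ^ ((m : ℝ) - 1) := Real.rpow_pos_of_pos hs _
  rw [powDensity, h1, h2, Real.rpow_natCast, smul_eq_mul, pow_mul]
  field_simp

theorem integrableOn_pow_mul_powDensity {m : ℕ} (hm : 0 < m) {f : ℝ → ℝ} {n : ℕ}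
    (h : IntegrableOn (fun s => s ^ (m * n) * f s) (Ioi 0)) :
    IntegrableOn (fun x => x ^ n * powDensity m f x) (Ioi 0) := by
  have hm0 : (m : ℝ) ≠ 0 := by positivity
  rw [← integrableOn_Ioi_comp_rpow_iff _ hm0, abs_of_nonneg (Nat.cast_nonneg m)]
  exact (integrableOn_congr_fun (fun s hs => smul_pow_mul_powDensity hm f n hs)
    measurableSet_Ioi).2 h

theorem integral_pow_mul_powDensity {m : ℕ} (hm : 0 < m) (f : ℝ → ℝ) (n : ℕ) :
    ∫ x in Ioi (0 : ℝ), x ^ n * powDensity m f x = ∫ s in Ioi (0 : ℝ), s ^ (m * n) * f s := by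
  have hm0 : (0 : ℝ) < m := by positivity
  rw [← integral_comp_rpow_Ioi_of_pos hm0]
  exact setIntegral_congr_fun measurableSet_Ioi fun s hs => smul_pow_mul_powDensity hm f n hs

theorem isStieltjesSolution_powDensity {m : ℕ} (hm : 0 < m) {f : ℝ → ℝ} {ρ : ℕ → ℝ}
    (hcont : ContinuousOn f (Ioi 0)) (hpos : ∀ s, 0 < s → 0 < f s)
    (hint : ∀ n : ℕ, IntegrableOn (fun s => s ^ (m * n) * f s) (Ioi 0))
    (hmom : ∀ n : ℕ, ∫ s in Ioi (0 : ℝ), s ^ (m * n) * f s = ρ n) :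
    IsStieltjesSolution ρ (powDensity m f) := by
  have hm0 : (m : ℝ) ≠ 0 := by positivity
  have hrpow : ∀ a : ℝ, ContinuousOn (fun x : ℝ => x ^ a) (Ioi 0) := fun a =>
    continuousOn_id.rpow_const fun x hx => Or.inl (ne_of_gt hx)
  refine ⟨?_, fun x hx => ?_, fun n => integrableOn_pow_mul_powDensity hm (hint n),
    fun n => (integral_pow_mul_powDensity hm f n).trans (hmom n)⟩
  · refine ContinuousOn.mul (continuousOn_const.div (continuousOn_const.mul (hrpow _)) ?_)
      (hcont.comp (hrpow _) fun x hx => Real.rpow_pos_of_pos hx _)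
    intro x hx
    exact mul_ne_zero hm0 (Real.rpow_pos_of_pos hx _).ne'
  · have := Real.rpow_pos_of_pos hx ((m - 1 : ℝ) / m)
    exact mul_pos (by positivity) (hpos _ (Real.rpow_pos_of_pos hx _))

theorem IsStieltjesSolution.congr {ρ : ℕ → ℝ} {W V : ℝ → ℝ} (h : IsStieltjesSolution ρ W)
    (hWV : EqOn W V (Ioi 0)) : IsStieltjesSolution ρ V := by
  have hmul : ∀ n : ℕ, EqOn (fun x => x ^ n * W x) (fun x => x ^ n * V x) (Ioi 0) :=
    fun n x hx => congrArg (x ^ n * ·) (hWV hx)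
  refine ⟨h.continuousOn.congr hWV.symm, fun x hx => hWV hx ▸ h.pos x hx, fun n => ?_, fun n => ?_⟩
  · exact (integrableOn_congr_fun (hmul n) measurableSet_Ioi).1 (h.integrable n)
  · rw [← setIntegral_congr_fun measurableSet_Ioi (hmul n)]
    exact h.moment n

/-! ### Laplace transforms of monomials -/

theorem integrableOn_pow_mul_exp_neg_mul (k : ℕ) {c : ℝ} (hc : 0 < c) :
    IntegrableOn (fun s : ℝ => s ^ k * Real.exp (-(c * s))) (Ioi 0) := by
  have h := integrableOn_rpow_mul_exp_neg_mul_rpow (p := 1) (s := k) (b := c)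
    (by have : (0 : ℝ) ≤ k := k.cast_nonneg
        linarith) one_pos hc
  simpa only [Real.rpow_natCast, Real.rpow_one, neg_mul] using h

theorem integral_pow_mul_exp_neg_mul (k : ℕ) {c : ℝ} (hc : 0 < c) :
    ∫ s in Ioi (0 : ℝ), s ^ k * Real.exp (-(c * s)) = k ! / c ^ (k + 1) := by
  have h := Real.integral_rpow_mul_exp_neg_mul_Ioi (a := k + 1) (r := c) (by positivity) hc
  simp only [add_sub_cancel_right, Real.rpow_natCast] at h
  rw [h, Real.Gamma_nat_eq_factorial, ← Nat.cast_succ, Real.rpow_natCast, one_div, inv_pow]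
  exact (div_eq_inv_mul _ _).symm

theorem norm_pow_mul_cexp_neg_mul (k : ℕ) (p : ℂ) {s : ℝ} (hs : 0 < s) :
    ‖(s : ℂ) ^ k * Complex.exp (-(p * s))‖ = s ^ k * Real.exp (-(p.re * s)) := by
  rw [norm_mul, norm_pow, Complex.norm_real, Real.norm_of_nonneg hs.le, Complex.norm_exp]
  simp

theorem integrableOn_pow_mul_cexp_neg_mul (k : ℕ) {p : ℂ} (hp : 0 < p.re) :
    IntegrableOn (fun s : ℝ => (s : ℂ) ^ k * Complex.exp (-(p * s))) (Ioi 0) := by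
  refine (integrableOn_pow_mul_exp_neg_mul k hp).mono' (by fun_prop) ?_
  filter_upwards [ae_restrict_mem measurableSet_Ioi] with s hs
  exact (norm_pow_mul_cexp_neg_mul k p hs).le

theorem integral_pow_mul_cexp_neg_mul (k : ℕ) {p : ℂ} (hp : 0 < p.re) :
    ∫ s in Ioi (0 : ℝ), (s : ℂ) ^ k * Complex.exp (-(p * s)) = k ! / p ^ (k + 1) := by
  have hp0 : p ≠ 0 := by
    rintro rfl
    simp at hp
  have hexp : ∀ s : ℝ, HasDerivAt (fun s : ℝ => Complex.exp (-(p * s)))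
      (-p * Complex.exp (-(p * s))) s := by
    intro s
    have h1 : HasDerivAt (fun s : ℝ => -(p * (s : ℂ))) (-p) s := by
      simpa using ((Complex.ofRealCLM.hasDerivAt (x := s)).const_mul p).fun_neg
    simpa [mul_comm] using h1.cexp
  have htend : ∀ j : ℕ, Filter.Tendsto (fun s : ℝ => (s : ℂ) ^ j * Complex.exp (-(p * s)))
      Filter.atTop (nhds 0) := by
    intro j
    rw [tendsto_zero_iff_norm_tendsto_zero]
    have h := tendsto_rpow_mul_exp_neg_mul_atTop_nhds_zero (j : ℝ) p.re hp
    refine h.congr' ?_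
    filter_upwards [Filter.eventually_gt_atTop 0] with s hs
    rw [norm_pow_mul_cexp_neg_mul j p hs, Real.rpow_natCast, neg_mul]
  induction k with
  | zero =>
    have hd : ∀ s ∈ Ioi (0 : ℝ), HasDerivAt (fun s : ℝ => -p⁻¹ * Complex.exp (-(p * s)))
        ((s : ℂ) ^ 0 * Complex.exp (-(p * s))) s := by
      intro s _
      refine ((hexp s).const_mul (-p⁻¹)).congr_deriv ?_
      field_simp
    have ht : Filter.Tendsto (fun s : ℝ => -p⁻¹ * Complex.exp (-(p * s))) Filter.atTop
        (nhds 0) := by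
      simpa using (htend 0).const_mul (-p⁻¹)
    rw [integral_Ioi_of_hasDerivAt_of_tendsto (by fun_prop) hd
      (integrableOn_pow_mul_cexp_neg_mul 0 hp) ht]
    simp
  | succ k ih =>
    have hd : ∀ s ∈ Ioi (0 : ℝ), HasDerivAt
        (fun s : ℝ => (s : ℂ) ^ (k + 1) * Complex.exp (-(p * s)))
        ((k + 1) * ((s : ℂ) ^ k * Complex.exp (-(p * s))) -
          p * ((s : ℂ) ^ (k + 1) * Complex.exp (-(p * s)))) s := by
      intro s _
      have h1 : HasDerivAt (fun s : ℝ => (s : ℂ) ^ (k + 1)) ((k + 1) * (s : ℂ) ^ k) s := by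
        simpa using (Complex.ofRealCLM.hasDerivAt (x := s)).fun_pow (k + 1)
      refine (h1.mul (hexp s)).congr_deriv ?_
      ring
    have hi1 := (integrableOn_pow_mul_cexp_neg_mul k hp).const_mul (k + 1 : ℂ)
    have hi2 := (integrableOn_pow_mul_cexp_neg_mul (k + 1) hp).const_mul p
    have h := integral_Ioi_of_hasDerivAt_of_tendsto (by fun_prop) hd (hi1.sub hi2) (htend (k + 1))
    rw [integral_sub hi1 hi2, integral_const_mul, integral_const_mul, ih] at h
    simp only [Complex.ofReal_zero, ne_eq, Nat.add_eq_zero_iff, one_ne_zero, and_false,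
      not_false_eq_true, zero_pow, zero_mul, sub_zero] at h
    rw [← mul_right_inj' hp0, ← sub_eq_zero.1 h, Nat.factorial_succ]
    push_cast
    field_simp
    ring

/-! ### Functions with vanishing moments -/

/-- For `m > 2` a small multiple of `s ^ k * Im (p ^ (k + 1) * exp (-p * s))`, where `p` has real
part `c` and argument `π / m`, is orthogonal to all `s ^ (m * n)`: since `p ^ m` is real, so is
`p ^ (k + 1) * (m * n + k)! / p ^ (m * n + k + 1)`. -/
theorem exists_vanishing_moments {m : ℕ} (hm : 2 < m) (k : ℕ) {c : ℝ} (hc : 0 < c) :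
    ∃ h : ℝ → ℝ, Continuous h ∧
      (∀ n : ℕ, IntegrableOn (fun s => s ^ (m * n) * h s) (Ioi 0)) ∧
      (∀ n : ℕ, ∫ s in Ioi (0 : ℝ), s ^ (m * n) * h s = 0) ∧
      (∀ s, 0 < s → |h s| < s ^ k * Real.exp (-(c * s))) ∧ ∃ s, 0 < s ∧ h s ≠ 0 := by
  have hm0 : (0 : ℝ) < m := by positivity
  have hm2 : (2 : ℝ) < m := by exact_mod_cast hm
  set θ : ℝ := Real.pi / m with hθ
  have hθ0 : 0 < θ := by positivity
  have hθ2 : θ < Real.pi / 2 := div_lt_div_of_pos_left Real.pi_pos two_pos hm2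
  have hcos : 0 < Real.cos θ := Real.cos_pos_of_mem_Ioo ⟨by linarith, hθ2⟩
  have hsin : 0 < Real.sin θ := Real.sin_pos_of_pos_of_lt_pi hθ0 (by linarith)
  set R : ℝ := c / Real.cos θ with hR
  have hR0 : 0 < R := by positivity
  set p : ℂ := R * Complex.exp (θ * Complex.I) with hp
  have hre : p.re = c := by
    rw [hp, Complex.re_ofReal_mul, Complex.exp_ofReal_mul_I_re, hR]
    field_simp
  have him : 0 < p.im := by
    rw [hp, Complex.im_ofReal_mul, Complex.exp_ofReal_mul_I_im]
    positivity
  have hp0 : p ≠ 0 := by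
    intro h0
    rw [h0] at him
    simp at him
  have hmC : (m : ℂ) ≠ 0 := by exact_mod_cast hm0.ne'
  have hpm : p ^ m = ((-R ^ m : ℝ) : ℂ) := by
    rw [hp, mul_pow, ← Complex.exp_nat_mul]
    have : (m : ℂ) * (θ * Complex.I) = Real.pi * Complex.I := by
      rw [hθ]
      push_cast
      field_simp
    rw [this, Complex.exp_pi_mul_I]
    push_cast
    ring
  have hpre : 0 < p.re := hre ▸ hc
  set q : ℂ := p ^ (k + 1) with hq
  have hq0 : q ≠ 0 := pow_ne_zero _ hp0
  have hqn : 0 < ‖q‖ := norm_pos_iff.2 hq0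
  have hform : ∀ n : ℕ, ∀ s : ℝ,
      s ^ (m * n) * ((2 * ‖q‖)⁻¹ * (s ^ k * (q * Complex.exp (-(p * s))).im)) =
      (((2 * ‖q‖)⁻¹ : ℝ) * (q * ((s : ℂ) ^ (m * n + k) * Complex.exp (-(p * s))))).im := by
    intro n s
    have : q * ((s : ℂ) ^ (m * n + k) * Complex.exp (-(p * s))) =
        ((s ^ (m * n + k) : ℝ) : ℂ) * (q * Complex.exp (-(p * s))) := by
      push_cast
      ring
    rw [Complex.im_ofReal_mul, this, Complex.im_ofReal_mul]
    ring
  have hci : ∀ n : ℕ, IntegrableOn (fun s : ℝ =>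
      (((2 * ‖q‖)⁻¹ : ℝ) : ℂ) * (q * ((s : ℂ) ^ (m * n + k) * Complex.exp (-(p * s))))) (Ioi 0) :=
    fun n => ((integrableOn_pow_mul_cexp_neg_mul (m * n + k) hpre).const_mul q).const_mul _
  refine ⟨fun s => (2 * ‖q‖)⁻¹ * (s ^ k * (q * Complex.exp (-(p * s))).im), ?_, fun n => ?_,
    fun n => ?_, fun s hs => ?_, ?_⟩
  · have : Continuous fun s : ℝ => (q * Complex.exp (-(p * s))).im :=
      Complex.continuous_im.comp (by fun_prop)
    fun_prop
  · simp only [hform]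
    exact (hci n).im
  · simp only [hform]
    refine (integral_im (hci n)).trans ?_
    rw [integral_const_mul, integral_const_mul,
      integral_pow_mul_cexp_neg_mul _ hpre]
    have : (((2 * ‖q‖)⁻¹ : ℝ) : ℂ) * (q * ((m * n + k)! / p ^ (m * n + k + 1))) =
        (((2 * ‖q‖)⁻¹ * ((m * n + k)! / (-R ^ m) ^ n) : ℝ) : ℂ) := by
      push_cast
      congr 1
      have hpm' : (-(R : ℂ) ^ m) = p ^ m := by rw [hpm]; push_cast; ring
      rw [hpm', hq, add_assoc, pow_add p (m * n), pow_mul]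
      field_simp
    exact (congrArg Complex.im this).trans (Complex.ofReal_im _)
  · have hle : |(q * Complex.exp (-(p * s))).im| ≤ ‖q‖ * Real.exp (-(c * s)) := by
      refine (Complex.abs_im_le_norm _).trans ?_
      rw [norm_mul, Complex.norm_exp]
      simp [hre]
    have hsk : 0 < s ^ k := pow_pos hs k
    rw [abs_mul, abs_mul, abs_of_pos hsk, abs_of_pos (by positivity : 0 < (2 * ‖q‖)⁻¹)]
    calc (2 * ‖q‖)⁻¹ * (s ^ k * |(q * Complex.exp (-(p * s))).im|)
        ≤ (2 * ‖q‖)⁻¹ * (s ^ k * (‖q‖ * Real.exp (-(c * s)))) := by gcongr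
      _ = s ^ k * Real.exp (-(c * s)) / 2 := by field_simp
      _ < s ^ k * Real.exp (-(c * s)) := half_lt_self (by positivity)
  · -- the phase of `q * exp (-p * s)` is `arg q - s * p.im`; make it equal to `-3π/2`
    have harg := Complex.neg_pi_lt_arg q
    have hs : 0 < (Complex.arg q + 3 * Real.pi / 2) / p.im :=
      div_pos (by linarith [Real.pi_pos]) him
    set s : ℝ := (Complex.arg q + 3 * Real.pi / 2) / p.im with hs_def
    refine ⟨s, hs, ?_⟩
    have hval : q * Complex.exp (-(p * s)) =
        ((‖q‖ * Real.exp (-(p.re * s)) : ℝ) : ℂ) * Complex.I := by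
      have h1 : q = ‖q‖ * Complex.exp (Complex.arg q * Complex.I) :=
        (Complex.norm_mul_exp_arg_mul_I q).symm
      have h2 : (Complex.arg q * Complex.I : ℂ) + -(p * s) =
          ((-(p.re * s) : ℝ) : ℂ) + (Real.pi / 2 * Complex.I - 2 * Real.pi * Complex.I) := by
        have h3 : p.im * s = Complex.arg q + 3 * Real.pi / 2 := by
          rw [hs_def]
          field_simp
        apply Complex.ext
        · simp
        · simp
          linarith
      calc q * Complex.exp (-(p * s))
          = ‖q‖ * (Complex.exp (Complex.arg q * Complex.I) * Complex.exp (-(p * s))) := by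
            rw [← mul_assoc, ← h1]
        _ = _ := by
            rw [← Complex.exp_add, h2, Complex.exp_add, Complex.exp_sub,
              Complex.exp_pi_div_two_mul_I, Complex.exp_two_pi_mul_I]
            push_cast
            ring
    simp only [hval, Complex.im_ofReal_mul, Complex.I_im]
    positivity

/-- A density `f` with `f s ≥ s ^ k * exp (-c * s)` dominates a function with vanishing moments of
order `m * n`, which can be added to it. -/
theorem exists_isStieltjesSolution_ne_powDensity {m : ℕ} (hm : 2 < m) (k : ℕ) {c : ℝ} (hc : 0 < c)
    {f : ℝ → ℝ} {ρ : ℕ → ℝ} (hcont : ContinuousOn f (Ioi 0))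
    (hlow : ∀ s, 0 < s → s ^ k * Real.exp (-(c * s)) ≤ f s)
    (hint : ∀ n : ℕ, IntegrableOn (fun s => s ^ (m * n) * f s) (Ioi 0))
    (hmom : ∀ n : ℕ, ∫ s in Ioi (0 : ℝ), s ^ (m * n) * f s = ρ n) :
    ∃ V : ℝ → ℝ, IsStieltjesSolution ρ V ∧ ∃ x : ℝ, 0 < x ∧ V x ≠ powDensity m f x := by
  obtain ⟨h, hhc, hhi, hhm, hhb, s, hs, hhs⟩ := exists_vanishing_moments hm k hc
  have hm0 : (m : ℝ) ≠ 0 := by positivity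
  refine ⟨powDensity m fun s => f s + h s, isStieltjesSolution_powDensity (by omega)
    (hcont.add hhc.continuousOn) (fun s hs => ?_) (fun n => ?_) (fun n => ?_),
    s ^ m, pow_pos hs m, ?_⟩
  · linarith [neg_abs_le (h s), hhb s hs, hlow s hs]
  · simp only [mul_add]
    exact (hint n).add (hhi n)
  · simp only [mul_add]
    rw [integral_add (hint n) (hhi n), hmom, hhm, add_zero]
  · have h2 : (s ^ m) ^ (1 / (m : ℝ)) = s := by
      rw [← Real.rpow_natCast, ← Real.rpow_mul hs.le, mul_one_div_cancel hm0, Real.rpow_one]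
    have h3 : 0 < (s ^ m) ^ ((m - 1 : ℝ) / m) := Real.rpow_pos_of_pos (pow_pos hs m) _
    rw [powDensity, powDensity, h2]
    intro heq
    have := mul_left_cancel₀ (by positivity) heq
    exact hhs (by linarith)

/-! ### The Bessel function -/

/-- The integrals `∫₀^∞ cosh^j t * exp (-z * cosh t) dt`, equal up to sign to the `j`-th derivative
of `besselK₀` at `z > 0`. -/
noncomputable def besselCosh (j : ℕ) (z : ℝ) : ℝ :=
  ∫ t in Ioi (0 : ℝ), Real.cosh t ^ j * Real.exp (-(z * Real.cosh t))

theorem besselCosh_zero : besselCosh 0 = besselK₀ := by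
  ext z
  simp [besselCosh, besselK₀]

theorem inv_cosh_le (t : ℝ) : (Real.cosh t)⁻¹ ≤ 2 * Real.exp (-t) := by
  rw [inv_le_comm₀ (Real.cosh_pos t) (by positivity), mul_inv, Real.exp_neg, inv_inv, Real.cosh_eq]
  linarith [Real.exp_pos (-t)]

/-- The bound that dominates all integrals `besselCosh j w` with `w ≥ z`; it comes from
`x ^ (j + 1) / (j + 1)! ≤ exp x` at `x = z * cosh t`. -/
theorem cosh_pow_mul_exp_le (j : ℕ) {z : ℝ} (hz : 0 < z) (t : ℝ) :
    Real.cosh t ^ j * Real.exp (-(z * Real.cosh t)) ≤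
      (j + 1)! / z ^ (j + 1) * (2 * Real.exp (-t)) := by
  have hc := Real.cosh_pos t
  have h := Real.pow_div_factorial_le_exp (z * Real.cosh t) (by positivity) (j + 1)
  have hf : (0 : ℝ) < (j + 1)! := by positivity
  rw [div_le_iff₀ hf] at h
  refine le_trans ?_ (mul_le_mul_of_nonneg_left (inv_cosh_le t) (by positivity))
  rw [Real.exp_neg, ← div_eq_mul_inv, ← div_eq_mul_inv, div_div,
    div_le_div_iff₀ (Real.exp_pos _) (by positivity)]
  calc Real.cosh t ^ j * (z ^ (j + 1) * Real.cosh t) = (z * Real.cosh t) ^ (j + 1) := by ring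
    _ ≤ (j + 1)! * Real.exp (z * Real.cosh t) := by linarith

theorem integrableOn_besselCosh (j : ℕ) {z : ℝ} (hz : 0 < z) :
    IntegrableOn (fun t => Real.cosh t ^ j * Real.exp (-(z * Real.cosh t))) (Ioi 0) := by
  have hcosh := Real.continuous_cosh
  refine Integrable.mono' (((integrableOn_exp_neg_Ioi 0).const_mul 2).const_mul
    ((j + 1)! / z ^ (j + 1))) (by fun_prop) (ae_of_all _ fun t => ?_)
  have := Real.cosh_pos t
  rw [Real.norm_of_nonneg (by positivity)]
  exact cosh_pow_mul_exp_le j hz t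

theorem hasDerivAt_besselCosh (j : ℕ) {z : ℝ} (hz : 0 < z) :
    HasDerivAt (besselCosh j) (-besselCosh (j + 1) z) z := by
  have hcosh := Real.continuous_cosh
  have h := (hasDerivAt_integral_of_dominated_loc_of_deriv_le (μ := volume.restrict (Ioi (0 : ℝ)))
    (F := fun z t => Real.cosh t ^ j * Real.exp (-(z * Real.cosh t)))
    (F' := fun z t => -(Real.cosh t ^ (j + 1) * Real.exp (-(z * Real.cosh t))))
    (bound := fun t => Real.cosh t ^ (j + 1) * Real.exp (-(z / 2 * Real.cosh t)))
    (Ioi_mem_nhds (half_lt_self hz)) (Filter.Eventually.of_forall fun w => by fun_prop)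
    (integrableOn_besselCosh j hz) (by fun_prop) (ae_of_all _ fun t w hw => ?_)
    (integrableOn_besselCosh (j + 1) (half_pos hz)) (ae_of_all _ fun t w hw => ?_)).2
  · rwa [integral_neg] at h
  · have := Real.cosh_pos t
    rw [norm_neg, Real.norm_of_nonneg (by positivity)]
    have hw' : z / 2 ≤ w := le_of_lt hw
    gcongr
  · have h1 : HasDerivAt (fun w : ℝ => -(w * Real.cosh t)) (-Real.cosh t) w := by
      simpa using ((hasDerivAt_id w).mul_const (Real.cosh t)).fun_neg
    refine (h1.exp.const_mul (Real.cosh t ^ j)).congr_deriv ?_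
    ring

/-- Bessel's equation `z * K₀'' + K₀' = z * K₀`, from an integration by parts. -/
theorem mul_besselCosh_two {z : ℝ} (hz : 0 < z) :
    z * besselCosh 2 z = besselCosh 1 z + z * besselCosh 0 z := by
  have hd : ∀ t ∈ Ioi (0 : ℝ), HasDerivAt
      (fun t => Real.sinh t * Real.exp (-(z * Real.cosh t)))
      (Real.cosh t ^ 1 * Real.exp (-(z * Real.cosh t)) -
        z * (Real.cosh t ^ 2 * Real.exp (-(z * Real.cosh t)) -
          Real.cosh t ^ 0 * Real.exp (-(z * Real.cosh t)))) t := by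
    intro t _
    have h1 : HasDerivAt (fun t : ℝ => -(z * Real.cosh t)) (-(z * Real.sinh t)) t :=
      ((Real.hasDerivAt_cosh t).const_mul z).fun_neg
    refine ((Real.hasDerivAt_sinh t).mul h1.exp).congr_deriv ?_
    linear_combination (z * Real.exp (-(z * Real.cosh t))) * Real.cosh_sq t
  have hsinh := Real.continuous_sinh
  have hcosh := Real.continuous_cosh
  have ht : Filter.Tendsto (fun t => Real.sinh t * Real.exp (-(z * Real.cosh t))) Filter.atTop
      (nhds 0) := by
    have hlim : Filter.Tendsto (fun t : ℝ => (1 + 1)! / z ^ (1 + 1) * (2 * Real.exp (-t)))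
        Filter.atTop (nhds 0) := by
      simpa using (Real.tendsto_exp_neg_atTop_nhds_zero.const_mul 2).const_mul
        (((1 + 1)! : ℕ) / z ^ (1 + 1))
    refine squeeze_zero_norm (fun t => ?_) hlim
    refine le_trans ?_ (cosh_pow_mul_exp_le 1 hz t)
    rw [norm_mul, Real.norm_of_nonneg (Real.exp_pos _).le, pow_one]
    gcongr
    rw [Real.norm_eq_abs, abs_le]
    constructor <;> rw [Real.sinh_eq, Real.cosh_eq] <;>
      linarith [Real.exp_pos t, Real.exp_pos (-t)]
  have i0 := integrableOn_besselCosh 0 hz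
  have i1 := integrableOn_besselCosh 1 hz
  have i2 := integrableOn_besselCosh 2 hz
  have i3 : IntegrableOn (fun t => z * (Real.cosh t ^ 2 * Real.exp (-(z * Real.cosh t)) -
      Real.cosh t ^ 0 * Real.exp (-(z * Real.cosh t)))) (Ioi 0) := (i2.sub i0).const_mul z
  have h := integral_Ioi_of_hasDerivAt_of_tendsto (by fun_prop) hd (i1.sub i3) ht
  rw [integral_sub i1 i3, integral_const_mul, integral_sub i2 i0] at h
  simp only [Real.sinh_zero, zero_mul, sub_zero] at h
  change besselCosh 1 z - z * (besselCosh 2 z - besselCosh 0 z) = 0 at h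
  linarith

theorem besselCosh_zero_le_one {z : ℝ} (hz : 0 < z) : besselCosh 0 z ≤ besselCosh 1 z := by
  refine integral_mono (integrableOn_besselCosh 0 hz) (integrableOn_besselCosh 1 hz) fun t => ?_
  simp only [pow_zero, pow_one]
  exact mul_le_mul_of_nonneg_right (Real.one_le_cosh t) (Real.exp_pos _).le

/-- A lower bound from the part `0 < t ≤ 1` of the integral, where `cosh t ≤ 2`. -/
theorem exp_neg_two_mul_le_besselK₀ {z : ℝ} (hz : 0 < z) : Real.exp (-(2 * z)) ≤ besselK₀ z := by
  have hcosh1 : Real.cosh 1 ≤ 2 := by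
    have h1 : Real.exp (-1) ≤ 1 := Real.exp_le_one_iff.2 (by norm_num)
    rw [Real.cosh_eq]
    linarith [Real.exp_one_lt_d9]
  have hi : IntegrableOn (fun t => Real.exp (-(z * Real.cosh t))) (Ioi 0) := by
    simpa using integrableOn_besselCosh 0 hz
  calc Real.exp (-(2 * z)) = ∫ _ in Ioc (0 : ℝ) 1, Real.exp (-(2 * z)) := by simp
    _ ≤ ∫ t in Ioc (0 : ℝ) 1, Real.exp (-(z * Real.cosh t)) := by
        refine setIntegral_mono_on (by simp) (hi.mono_set Ioc_subset_Ioi_self) measurableSet_Ioc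
          fun t ht => ?_
        have : Real.cosh t ≤ 2 := by
          refine le_trans (Real.cosh_le_cosh.2 ?_) hcosh1
          rw [abs_of_pos ht.1, abs_one]
          exact ht.2
        rw [Real.exp_le_exp, mul_comm 2 z]
        exact neg_le_neg (mul_le_mul_of_nonneg_left this hz.le)
    _ ≤ besselK₀ z := setIntegral_mono_set hi (ae_of_all _ fun t => (Real.exp_pos _).le)
        Ioc_subset_Ioi_self.eventuallyLE

theorem besselK₀_pos {z : ℝ} (hz : 0 < z) : 0 < besselK₀ z :=
  (Real.exp_pos _).trans_le (exp_neg_two_mul_le_besselK₀ hz)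

theorem besselK₀_le {z : ℝ} (hz : 0 < z) : besselK₀ z ≤ 2 / z := by
  rw [← besselCosh_zero]
  calc besselCosh 0 z ≤ ∫ t in Ioi (0 : ℝ), (0 + 1)! / z ^ (0 + 1) * (2 * Real.exp (-t)) :=
        integral_mono (integrableOn_besselCosh 0 hz)
          (((integrableOn_exp_neg_Ioi 0).const_mul 2).const_mul _)
          fun t => cosh_pow_mul_exp_le 0 hz t
    _ = 2 / z := by
        rw [integral_const_mul, integral_const_mul, integral_exp_neg_Ioi_zero]
        simp [div_eq_inv_mul]

theorem continuousOn_besselK₀ : ContinuousOn besselK₀ (Ioi 0) := fun _ hz =>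
  (besselCosh_zero ▸ hasDerivAt_besselCosh 0 hz).continuousAt.continuousWithinAt

/-- The function `-z * K₀' / K₀` increases: by Bessel's equation its derivative is
`z * (K₀'² - K₀²) / K₀²`, and `K₀ ≤ -K₀'`. -/
theorem monotoneOn_mul_besselCosh_div :
    MonotoneOn (fun z => z * besselCosh 1 z / besselCosh 0 z) (Ioi 0) := by
  have hpos : ∀ z ∈ Ioi (0 : ℝ), 0 < besselCosh 0 z := fun z hz => by
    rw [besselCosh_zero]
    exact besselK₀_pos hz
  have hd : ∀ z ∈ Ioi (0 : ℝ), HasDerivAt (fun z => z * besselCosh 1 z / besselCosh 0 z)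
      (z * (besselCosh 1 z ^ 2 - besselCosh 0 z ^ 2) / besselCosh 0 z ^ 2) z := by
    intro z hz
    refine (((hasDerivAt_id z).fun_mul (hasDerivAt_besselCosh 1 hz)).fun_div
      (hasDerivAt_besselCosh 0 hz) (hpos z hz).ne').congr_deriv ?_
    congr 1
    simp only [id]
    linear_combination (-besselCosh 0 z) * mul_besselCosh_two hz
  refine monotoneOn_of_deriv_nonneg (convex_Ioi 0)
    (fun z hz => (hd z hz).continuousAt.continuousWithinAt)
    (fun z hz => (hd z (interior_subset hz)).differentiableAt.differentiableWithinAt) ?_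
  intro z hz
  have hz' : z ∈ Ioi (0 : ℝ) := interior_subset hz
  rw [(hd z hz').deriv]
  have h1 : besselCosh 0 z ^ 2 ≤ besselCosh 1 z ^ 2 :=
    pow_le_pow_left₀ (hpos z hz').le (besselCosh_zero_le_one hz') 2
  exact div_nonneg (mul_nonneg (le_of_lt hz') (sub_nonneg.2 h1)) (sq_nonneg _)

theorem convexOn_neg_log_besselK₀_exp {a : ℝ} (ha : 0 < a) :
    ConvexOn ℝ univ fun y => -Real.log (besselK₀ (2 * Real.exp (a * y))) := by
  have hpos : ∀ y : ℝ, 0 < 2 * Real.exp (a * y) := fun y => by positivity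
  have hd : ∀ y, HasDerivAt (fun y => -Real.log (besselK₀ (2 * Real.exp (a * y))))
      (a * (2 * Real.exp (a * y) * besselCosh 1 (2 * Real.exp (a * y)) /
        besselCosh 0 (2 * Real.exp (a * y)))) y := by
    intro y
    have h1 : HasDerivAt (fun y => 2 * Real.exp (a * y)) (2 * (Real.exp (a * y) * a)) y := by
      have : HasDerivAt (fun y => a * y) a y := by simpa using (hasDerivAt_id y).const_mul a
      exact this.exp.const_mul 2
    have h2 := (hasDerivAt_besselCosh 0 (hpos y)).comp y h1
    rw [besselCosh_zero] at h2 ⊢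
    refine (h2.log (besselK₀_pos (hpos y)).ne').fun_neg.congr_deriv ?_
    simp only [Function.comp]
    ring
  refine Monotone.convexOn_univ_of_deriv (fun y => (hd y).differentiableAt) ?_
  intro x y hxy
  rw [(hd x).deriv, (hd y).deriv]
  refine mul_le_mul_of_nonneg_left (monotoneOn_mul_besselCosh_div (hpos x) (hpos y) ?_) ha.le
  gcongr

theorem integrableOn_inv_cosh_pow (M : ℕ) :
    IntegrableOn (fun t => ((Real.cosh t) ^ (2 * M + 2))⁻¹) (Ioi 0) := by
  have hcosh := Real.continuous_cosh
  have hne : ∀ t : ℝ, Real.cosh t ^ (2 * M + 2) ≠ 0 := fun t => pow_ne_zero _ (Real.cosh_pos t).ne'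
  refine Integrable.mono' ((integrableOn_exp_neg_Ioi 0).const_mul 2)
    ((hcosh.pow _).inv₀ hne).aestronglyMeasurable (ae_of_all _ fun t => ?_)
  have := Real.cosh_pos t
  rw [Real.norm_of_nonneg (by positivity)]
  refine le_trans ?_ (inv_cosh_le t)
  gcongr
  exact le_self_pow₀ (Real.one_le_cosh t) (by omega)

theorem tanh_tendsto_atTop : Filter.Tendsto Real.tanh Filter.atTop (nhds 1) := by
  have h : ∀ t, Real.tanh t = (1 - Real.exp (-t) * Real.exp (-t)) /
      (1 + Real.exp (-t) * Real.exp (-t)) := by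
    intro t
    have : Real.exp t * Real.exp (-t) = 1 := by rw [← Real.exp_add]; simp
    have h0 := Real.exp_pos t
    have h1 := Real.exp_pos (-t)
    rw [Real.tanh_eq_sinh_div_cosh, Real.sinh_eq, Real.cosh_eq,
      div_eq_div_iff (by positivity) (by positivity)]
    linear_combination Real.exp (-t) * this
  have he := Real.tendsto_exp_neg_atTop_nhds_zero
  have := (tendsto_const_nhds (x := (1 : ℝ)).sub (he.mul he)).div
    (tendsto_const_nhds (x := (1 : ℝ)).add (he.mul he)) (by simp)
  simp only [mul_zero, sub_zero, add_zero, div_one] at this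
  exact this.congr fun t => (h t).symm

/-- The Beta integral `∫₀^∞ cosh⁻²ᴹ⁻² t dt`, times the factor with which it occurs in the moments of
`4 * s * K₀ (2 * s)`, by the reduction formula that comes from
differentiating `tanh t * cosh⁻²ᴹ t`. -/
theorem integral_inv_cosh_pow (M : ℕ) :
    4 * (2 * M + 1)! / 4 ^ (M + 1) * ∫ t in Ioi (0 : ℝ), ((Real.cosh t) ^ (2 * M + 2))⁻¹ =
      (M ! : ℝ) ^ 2 := by
  have htanh : ∀ t, HasDerivAt Real.tanh ((Real.cosh t) ^ 2)⁻¹ t := by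
    intro t
    have hc := (Real.cosh_pos t).ne'
    have : Real.tanh = fun t => Real.sinh t / Real.cosh t := by
      ext t
      exact Real.tanh_eq_sinh_div_cosh t
    rw [this]
    refine ((Real.hasDerivAt_sinh t).fun_div (Real.hasDerivAt_cosh t) hc).congr_deriv ?_
    rw [← one_div]
    congr 1
    linear_combination Real.cosh_sq t
  have hct : Continuous Real.tanh :=
    continuous_iff_continuousAt.2 fun t => (htanh t).continuousAt
  induction M with
  | zero =>
    have h := integral_Ioi_of_hasDerivAt_of_tendsto hct.continuousWithinAt (fun t _ => htanh t)
      (integrableOn_inv_cosh_pow 0) tanh_tendsto_atTop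
    simp only [mul_zero, zero_add] at h ⊢
    rw [h]
    simp
  | succ M ih =>
    have hd : ∀ t ∈ Ioi (0 : ℝ), HasDerivAt
        (fun t => Real.tanh t * ((Real.cosh t) ^ (2 * M + 2))⁻¹)
        ((2 * M + 3) * ((Real.cosh t) ^ (2 * (M + 1) + 2))⁻¹ -
          (2 * M + 2) * ((Real.cosh t) ^ (2 * M + 2))⁻¹) t := by
      intro t _
      have hc := (Real.cosh_pos t).ne'
      refine ((htanh t).fun_mul (((Real.hasDerivAt_cosh t).fun_pow (2 * M + 2)).fun_inv
        (pow_ne_zero _ hc))).congr_deriv ?_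
      have hs : Real.sinh t * Real.sinh t = Real.cosh t ^ 2 - 1 := by
        linear_combination -Real.cosh_sq t
      have e1 : Real.cosh t ^ (2 * (M + 1) + 2) = Real.cosh t ^ (2 * M + 2) * Real.cosh t ^ 2 := by
        ring
      have e2 : 2 * M + 2 - 1 = 2 * M + 1 := by omega
      have e3 : Real.cosh t ^ (2 * M + 2) = Real.cosh t ^ (2 * M + 1) * Real.cosh t := by ring
      rw [Real.tanh_eq_sinh_div_cosh, e1, e2, e3]
      have hp := pow_ne_zero (2 * M + 1) hc
      push_cast
      field_simp
      linear_combination (-(2 * M + 2) : ℝ) * hs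
    have hcosh := Real.continuous_cosh
    have ht : Filter.Tendsto (fun t => Real.tanh t * ((Real.cosh t) ^ (2 * M + 2))⁻¹)
        Filter.atTop (nhds (1 * 0)) := by
      refine tanh_tendsto_atTop.mul ?_
      have hlim : Filter.Tendsto (fun t : ℝ => 2 * Real.exp (-t)) Filter.atTop (nhds 0) := by
        simpa using Real.tendsto_exp_neg_atTop_nhds_zero.const_mul 2
      refine squeeze_zero (fun t => ?_) (fun t => ?_) hlim
      · have := Real.cosh_pos t
        positivity
      · refine le_trans ?_ (inv_cosh_le t)
        have := Real.cosh_pos t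
        gcongr
        exact le_self_pow₀ (Real.one_le_cosh t) (by omega)
    have hcont : Continuous fun t => Real.tanh t * ((Real.cosh t) ^ (2 * M + 2))⁻¹ :=
      hct.mul ((hcosh.pow _).inv₀ fun t => pow_ne_zero _ (Real.cosh_pos t).ne')
    have i1 := (integrableOn_inv_cosh_pow (M + 1)).const_mul (2 * M + 3 : ℝ)
    have i2 := (integrableOn_inv_cosh_pow M).const_mul (2 * M + 2 : ℝ)
    have h := integral_Ioi_of_hasDerivAt_of_tendsto hcont.continuousWithinAt hd (i1.sub i2) ht
    rw [integral_sub i1 i2, integral_const_mul, integral_const_mul] at h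
    simp only [Real.tanh_zero, mul_zero, zero_mul, sub_zero] at h
    have hf : ((2 * (M + 1) + 1)! : ℝ) = (2 * M + 3) * ((2 * M + 2) * (2 * M + 1)!) := by
      rw [show 2 * (M + 1) + 1 = (2 * M + 1 + 1) + 1 by ring, Nat.factorial_succ,
        Nat.factorial_succ]
      push_cast
      ring
    rw [hf, Nat.factorial_succ M]
    push_cast
    rw [mul_pow, ← ih, pow_succ (4 : ℝ) (M + 1)]
    linear_combination ((2 * M + 2) * (2 * M + 1)! / 4 ^ (M + 1)) * h

/-- The kernel whose `t`-integral is `s ^ (2M) * (4 * s * K₀ (2 * s))`, integrated over `s`. -/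
theorem integral_besselK₀_kernel (M : ℕ) (t : ℝ) :
    ∫ s in Ioi (0 : ℝ), 4 * (s ^ (2 * M + 1) * Real.exp (-(2 * Real.cosh t * s))) =
      4 * (2 * M + 1)! / 4 ^ (M + 1) * (Real.cosh t ^ (2 * M + 2))⁻¹ := by
  have hc := Real.cosh_pos t
  have h4 : (2 : ℝ) ^ (2 * M + 1 + 1) = 4 ^ (M + 1) := by
    rw [show 2 * M + 1 + 1 = 2 * (M + 1) by ring, pow_mul]
    norm_num
  rw [integral_const_mul, integral_pow_mul_exp_neg_mul _ (by positivity), mul_pow, h4]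
  field_simp

theorem integrable_besselK₀_kernel (M : ℕ) :
    Integrable (Function.uncurry fun s t : ℝ =>
      4 * (s ^ (2 * M + 1) * Real.exp (-(2 * Real.cosh t * s))))
      ((volume.restrict (Ioi 0)).prod (volume.restrict (Ioi 0))) := by
  have hcosh := Real.continuous_cosh
  rw [integrable_prod_iff' (by simp only [Function.uncurry_def]; fun_prop)]
  refine ⟨ae_of_all _ fun t => ?_, ?_⟩
  · have : 0 < 2 * Real.cosh t := mul_pos two_pos (Real.cosh_pos t)
    exact (integrableOn_pow_mul_exp_neg_mul _ this).const_mul 4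
  · refine ((integrableOn_inv_cosh_pow M).const_mul (4 * (2 * M + 1)! / 4 ^ (M + 1))).congr
      (ae_of_all _ fun t => ?_)
    simp only [Function.uncurry_apply_pair]
    rw [← integral_besselK₀_kernel]
    refine setIntegral_congr_fun measurableSet_Ioi fun s hs => ?_
    have : 0 < s := hs
    exact (Real.norm_of_nonneg (by positivity)).symm

theorem integral_kernel_eq_mul_besselK₀ (M : ℕ) (s : ℝ) :
    ∫ t in Ioi (0 : ℝ), 4 * (s ^ (2 * M + 1) * Real.exp (-(2 * Real.cosh t * s))) =
      s ^ (2 * M) * (4 * s * besselK₀ (2 * s)) := by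
  rw [integral_const_mul, integral_const_mul, besselK₀]
  simp only [mul_right_comm 2 _ s]
  ring

theorem integrableOn_pow_mul_besselK₀ (M : ℕ) :
    IntegrableOn (fun s => s ^ (2 * M) * (4 * s * besselK₀ (2 * s))) (Ioi 0) := by
  have h := (integrable_besselK₀_kernel M).integral_prod_left
  simp only [Function.uncurry_apply_pair, integral_kernel_eq_mul_besselK₀] at h
  exact h

/-- The even moments of `4 * s * K₀ (2 * s)`, by exchanging the order of integration. -/
theorem integral_pow_mul_besselK₀ (M : ℕ) :
    ∫ s in Ioi (0 : ℝ), s ^ (2 * M) * (4 * s * besselK₀ (2 * s)) = (M ! : ℝ) ^ 2 := by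
  simp only [← integral_kernel_eq_mul_besselK₀]
  rw [integral_integral_swap (integrable_besselK₀_kernel M)]
  simp only [integral_besselK₀_kernel]
  rw [integral_const_mul, integral_inv_cosh_pow]

/-! ### The Carleman series -/

/-- The bound `(2n)! ≤ (2n) ^ (2n)` makes the terms at least `1 / (2n)`. -/
theorem not_summable_carlemanTerm {ρ : ℕ → ℝ} (hpos : ∀ n, 0 < ρ n)
    (hρ : ∀ n, ρ n ≤ ((2 * n)! : ℕ)) : ¬ Summable (carlemanTerm ρ) := by
  intro h
  have hle : ∀ n : ℕ, 1 / 2 * (1 / ((n : ℝ) + 1)) ≤ carlemanTerm ρ n := by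
    intro n
    have hn : (0 : ℝ) < 2 * ((n : ℝ) + 1) := by positivity
    have h1 : ρ (n + 1) ≤ (2 * ((n : ℝ) + 1)) ^ (2 * ((n : ℝ) + 1)) := by
      refine (hρ (n + 1)).trans ?_
      have h2 : (((2 * (n + 1))! : ℕ) : ℝ) ≤ ((2 * (n + 1)) ^ (2 * (n + 1)) : ℕ) := by
        exact_mod_cast Nat.factorial_le_pow (2 * (n + 1))
      refine h2.trans (le_of_eq ?_)
      rw [Nat.cast_pow, ← Real.rpow_natCast]
      push_cast
      rfl
    calc 1 / 2 * (1 / ((n : ℝ) + 1)) =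
          ((2 * ((n : ℝ) + 1)) ^ (2 * ((n : ℝ) + 1))) ^ (-(1 / (2 * ((n : ℝ) + 1)))) := by
          rw [← Real.rpow_mul hn.le, mul_neg, mul_one_div_cancel hn.ne', Real.rpow_neg_one]
          field_simp
      _ ≤ carlemanTerm ρ n :=
          Real.rpow_le_rpow_of_nonpos (hpos _) h1 (neg_nonpos.2 (by positivity))
  have h1 := Summable.of_nonneg_of_le (fun n => by positivity) hle h
  rw [summable_mul_left_iff (by norm_num)] at h1
  exact Real.not_summable_one_div_natCast ((summable_nat_add_iff 1).1 (by simpa using h1))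

/-- The bound `(2n)! ≥ (2n / e) ^ (2n)` makes the terms at most `(e / (2n)) ^ 2`. -/
theorem summable_carlemanTerm {ρ : ℕ → ℝ} (hρ : ∀ n, (((2 * n)! : ℕ) : ℝ) ^ 2 ≤ ρ n) :
    Summable (carlemanTerm ρ) := by
  have hle : ∀ n : ℕ, carlemanTerm ρ n ≤ (Real.exp 1 / 2) ^ 2 * (1 / ((n : ℝ) + 1) ^ 2) := by
    intro n
    have hn : (0 : ℝ) < 2 * ((n : ℝ) + 1) := by positivity
    have h1 : (2 * ((n : ℝ) + 1) / Real.exp 1) ^ (2 * (n + 1)) ≤ ((2 * (n + 1))! : ℕ) := by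
      have h := Real.pow_div_factorial_le_exp (2 * ((n : ℝ) + 1)) hn.le (2 * (n + 1))
      rw [div_pow, div_le_iff₀ (by positivity), ← Real.exp_nat_mul]
      rw [div_le_iff₀ (by positivity)] at h
      refine h.trans (le_of_eq ?_)
      push_cast
      rw [mul_one, mul_comm (Real.exp _)]
    have h2 : ((2 * ((n : ℝ) + 1) / Real.exp 1) ^ 2) ^ (2 * ((n : ℝ) + 1)) ≤ ρ (n + 1) := by
      refine le_trans (le_of_eq ?_) ((pow_le_pow_left₀ (by positivity) h1 2).trans (hρ (n + 1)))
      rw [← pow_mul, mul_comm (2 * (n + 1)) 2, pow_mul, ← Real.rpow_natCast _ (2 * (n + 1))]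
      push_cast
      rfl
    calc carlemanTerm ρ n ≤ (((2 * ((n : ℝ) + 1) / Real.exp 1) ^ 2) ^ (2 * ((n : ℝ) + 1))) ^
          (-(1 / (2 * ((n : ℝ) + 1)))) :=
          Real.rpow_le_rpow_of_nonpos (by positivity) h2 (neg_nonpos.2 (by positivity))
      _ = (Real.exp 1 / 2) ^ 2 * (1 / ((n : ℝ) + 1) ^ 2) := by
          rw [← Real.rpow_mul (by positivity), mul_neg, mul_one_div_cancel hn.ne',
            Real.rpow_neg_one]
          field_simp
  refine Summable.of_nonneg_of_le (fun n => ?_) hle (Summable.mul_left _ ?_)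
  · exact Real.rpow_nonneg ((sq_nonneg _).trans (hρ _)) _
  · have := (summable_nat_add_iff 1).2 (Real.summable_one_div_nat_pow.2 one_lt_two)
    simpa using this

theorem moments₂_le_moments₁ (r n : ℕ) : moments₂ r n ≤ moments₁ r n := by
  have h : (r * n)! * (r * n)! ≤ (r * n + r * n)! :=
    Nat.le_of_dvd (Nat.factorial_pos _) (Nat.factorial_mul_factorial_dvd_factorial_add _ _)
  rw [moments₂, moments₁, sq, show 2 * r * n = r * n + r * n by ring]
  exact_mod_cast h

theorem sq_factorial_le_moments₂ {r : ℕ} (hr : 1 < r) (n : ℕ) :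
    (((2 * n)! : ℕ) : ℝ) ^ 2 ≤ moments₂ r n := by
  refine pow_le_pow_left₀ (by positivity) ?_ 2
  exact_mod_cast Nat.factorial_le (Nat.mul_le_mul_right n hr)

/-! ### The Krein integral -/

theorem integrableOn_rpow_half_add_div :
    IntegrableOn (fun x : ℝ => (x ^ (1 / 2 : ℝ) + x ^ (-(1 / 2) : ℝ)) / (1 + x ^ 2)) (Ioi 0) := by
  have hm : Measurable fun x : ℝ => (x ^ (1 / 2 : ℝ) + x ^ (-(1 / 2) : ℝ)) / (1 + x ^ 2) := by
    fun_prop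
  rw [← Ioc_union_Ioi_eq_Ioi zero_le_one]
  refine IntegrableOn.union ?_ ?_
  · have hi : IntegrableOn (fun x : ℝ => 2 * x ^ (-(1 / 2) : ℝ)) (Ioc 0 1) := by
      rw [← intervalIntegrable_iff_integrableOn_Ioc_of_le zero_le_one]
      exact (intervalIntegral.intervalIntegrable_rpow' (by norm_num)).const_mul 2
    refine hi.mono' hm.aestronglyMeasurable ?_
    filter_upwards [ae_restrict_mem measurableSet_Ioc] with x hx
    have h0 : 0 < x := hx.1
    have h1 : x ^ (1 / 2 : ℝ) ≤ x ^ (-(1 / 2) : ℝ) :=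
      Real.rpow_le_rpow_of_exponent_ge h0 hx.2 (by norm_num)
    have h2 : 0 < x ^ (-(1 / 2) : ℝ) := Real.rpow_pos_of_pos h0 _
    rw [Real.norm_of_nonneg (by positivity), div_le_iff₀ (by positivity)]
    nlinarith [mul_nonneg h2.le (sq_nonneg x)]
  · have hi : IntegrableOn (fun x : ℝ => 2 * x ^ (-(3 / 2) : ℝ)) (Ioi 1) :=
      (integrableOn_Ioi_rpow_of_lt (by norm_num) one_pos).const_mul 2
    refine hi.mono' hm.aestronglyMeasurable ?_
    filter_upwards [ae_restrict_mem measurableSet_Ioi] with x hx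
    have hx1 : 1 < x := hx
    have h0 : 0 < x := one_pos.trans hx1
    have h1 : x ^ (-(1 / 2) : ℝ) ≤ x ^ (1 / 2 : ℝ) :=
      Real.rpow_le_rpow_of_exponent_le hx1.le (by norm_num)
    have h2 : 0 < x ^ (-(3 / 2) : ℝ) := Real.rpow_pos_of_pos h0 _
    have h3 : x ^ (1 / 2 : ℝ) = x ^ (-(3 / 2) : ℝ) * x ^ 2 := by
      rw [← Real.rpow_natCast, ← Real.rpow_add h0]
      norm_num
    rw [Real.norm_of_nonneg (by positivity), div_le_iff₀ (by positivity)]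
    nlinarith

theorem abs_log_le_rpow_half_add {x : ℝ} (hx : 0 < x) :
    |Real.log x| ≤ 2 * (x ^ (1 / 2 : ℝ) + x ^ (-(1 / 2) : ℝ)) := by
  have h1 := Real.log_le_rpow_div hx.le one_half_pos
  have h2 := Real.log_le_rpow_div (inv_pos.2 hx).le one_half_pos
  rw [Real.log_inv, Real.inv_rpow hx.le, ← Real.rpow_neg hx.le] at h2
  have h3 : 0 < x ^ (1 / 2 : ℝ) := Real.rpow_pos_of_pos hx _
  have h4 : 0 < x ^ (-(1 / 2) : ℝ) := Real.rpow_pos_of_pos hx _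
  rw [abs_le]
  constructor <;> linarith

theorem one_le_rpow_half_add {x : ℝ} (hx : 0 < x) :
    1 ≤ x ^ (1 / 2 : ℝ) + x ^ (-(1 / 2) : ℝ) := by
  have h3 : 0 < x ^ (1 / 2 : ℝ) := Real.rpow_pos_of_pos hx _
  have h4 : 0 < x ^ (-(1 / 2) : ℝ) := Real.rpow_pos_of_pos hx _
  rcases le_total 1 x with h | h
  · linarith [Real.one_le_rpow h (by norm_num : (0 : ℝ) ≤ 1 / 2)]
  · linarith [Real.one_le_rpow_of_pos_of_le_one_of_nonpos hx h (by norm_num : (-(1 / 2) : ℝ) ≤ 0)]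

theorem log_powDensity {m : ℕ} (hm : 0 < m) {f : ℝ → ℝ} (hpos : ∀ s, 0 < s → 0 < f s) {x : ℝ}
    (hx : 0 < x) : Real.log (powDensity m f x) =
      Real.log (f (x ^ (1 / (m : ℝ)))) - Real.log m - (m - 1 : ℝ) / m * Real.log x := by
  have hm0 : (0 : ℝ) < m := by positivity
  have h1 : 0 < x ^ ((m - 1 : ℝ) / m) := Real.rpow_pos_of_pos hx _
  have h2 : 0 < f (x ^ (1 / (m : ℝ))) := hpos _ (Real.rpow_pos_of_pos hx _)
  rw [powDensity, Real.log_mul (by positivity) h2.ne', Real.log_div one_ne_zero (by positivity),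
    Real.log_mul hm0.ne' h1.ne', Real.log_rpow hx, Real.log_one]
  ring

/-- With `s = x ^ (2 / m)`, the hypothesis bounds the integrand by a multiple of
`x ^ (1 / 2) + x ^ (-1 / 2)` over `1 + x ^ 2`; this needs `2 / m ≤ 1 / 2`. -/
theorem kreinIntegralConverges_powDensity {m : ℕ} (hm : 4 ≤ m) {f : ℝ → ℝ}
    (hcont : ContinuousOn (powDensity m f) (Ioi 0)) (hpos : ∀ s, 0 < s → 0 < f s)
    (hf : ∀ s, 0 < s → |Real.log (f s)| ≤ 3 + |Real.log s| + 4 * s) :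
    KreinIntegralConverges (powDensity m f) := by
  have hm0 : (0 : ℝ) < m := by positivity
  have hm4 : (4 : ℝ) ≤ m := by exact_mod_cast hm
  have hsq : MapsTo (fun x : ℝ => x ^ 2) (Ioi 0) (Ioi 0) := fun x hx => pow_pos (mem_Ioi.1 hx) 2
  have hpow : ∀ x : ℝ, 0 < x → 0 < powDensity m f x := by
    intro x hx
    have h1 : 0 < x ^ ((m - 1 : ℝ) / m) := Real.rpow_pos_of_pos hx _
    exact mul_pos (by positivity) (hpos _ (Real.rpow_pos_of_pos hx _))
  have hmeas : ContinuousOn (fun x : ℝ => -Real.log (powDensity m f (x ^ 2)) / (1 + x ^ 2))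
      (Ioi 0) := by
    refine ContinuousOn.div (((hcont.comp (by fun_prop) hsq).log fun x hx => ?_).neg)
      (by fun_prop) fun x _ => by positivity
    exact (hpow _ (hsq hx)).ne'
  refine (integrableOn_rpow_half_add_div.const_mul (Real.log m + 16)).mono'
    (hmeas.aestronglyMeasurable measurableSet_Ioi) ?_
  filter_upwards [ae_restrict_mem measurableSet_Ioi] with x hx
  have hx0 : 0 < x := hx
  set G := x ^ (1 / 2 : ℝ) + x ^ (-(1 / 2) : ℝ) with hG
  have hG1 : 1 ≤ G := one_le_rpow_half_add hx0
  have hlog : |Real.log x| ≤ 2 * G := abs_log_le_rpow_half_add hx0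
  have hlogm : 0 ≤ Real.log m := Real.log_nonneg (by linarith)
  have hs : (x ^ 2) ^ (1 / (m : ℝ)) = x ^ (2 / (m : ℝ)) := by
    rw [← Real.rpow_natCast, ← Real.rpow_mul hx0.le]
    congr 1
    push_cast
    ring
  have hexp : 2 / (m : ℝ) ≤ 1 / 2 := by
    rw [div_le_div_iff₀ hm0 two_pos]
    linarith
  have hs1 : x ^ (2 / (m : ℝ)) ≤ 2 * G := by
    have h3 : 0 < x ^ (1 / 2 : ℝ) := Real.rpow_pos_of_pos hx0 _
    have h4 : 0 < x ^ (-(1 / 2) : ℝ) := Real.rpow_pos_of_pos hx0 _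
    rcases le_total 1 x with h | h
    · linarith [Real.rpow_le_rpow_of_exponent_le h hexp]
    · linarith [Real.rpow_le_one hx0.le h (by positivity : 0 ≤ 2 / (m : ℝ))]
  have hs2 : |Real.log (x ^ (2 / (m : ℝ)))| ≤ G := by
    rw [Real.log_rpow hx0, abs_mul, abs_of_pos (by positivity : 0 < 2 / (m : ℝ))]
    nlinarith [abs_nonneg (Real.log x)]
  have hfs := hf _ (Real.rpow_pos_of_pos hx0 (2 / (m : ℝ)))
  have hcoef : |(m - 1 : ℝ) / m * Real.log (x ^ 2)| ≤ 4 * G := by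
    have h1 : (m - 1 : ℝ) / m ≤ 1 := by
      rw [div_le_one hm0]
      linarith
    have h2 : 0 ≤ (m - 1 : ℝ) / m := div_nonneg (by linarith) hm0.le
    rw [abs_mul, abs_of_nonneg h2, Real.log_pow, abs_mul]
    push_cast
    rw [abs_two]
    nlinarith [abs_nonneg (Real.log x)]
  rw [norm_div, norm_neg, Real.norm_of_nonneg (by positivity : 0 ≤ 1 + x ^ 2), ← mul_div_assoc]
  refine div_le_div_of_nonneg_right ?_ (by positivity)
  rw [log_powDensity (by omega) hpos (hsq hx), hs, Real.norm_eq_abs]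
  have hmG : Real.log m ≤ Real.log m * G := le_mul_of_one_le_right hlogm hG1
  have h1 := abs_le.1 hfs
  have h2 := abs_le.1 hcoef
  rw [abs_le]
  constructor <;> linarith [h1.1, h1.2, h2.1, h2.2]

/-! ### Logarithmic convexity -/

theorem convexOn_const_add_mul (a b : ℝ) : ConvexOn ℝ univ fun y : ℝ => a + b * y :=
  ⟨convex_univ, fun x _ y _ s t _ _ hst => le_of_eq (by
    simp only [smul_eq_mul]
    linear_combination (-a) * hst)⟩

theorem convexOn_neg_log_powDensity_exp {m : ℕ} (hm : 0 < m) {f : ℝ → ℝ}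
    (hpos : ∀ s, 0 < s → 0 < f s)
    (hf : ConvexOn ℝ univ fun y => -Real.log (f (Real.exp (1 / m * y)))) :
    ConvexOn ℝ univ fun y => -Real.log (powDensity m f (Real.exp y)) := by
  refine ((convexOn_const_add_mul (Real.log m) ((m - 1 : ℝ) / m)).add hf).congr fun y _ => ?_
  simp only [Pi.add_apply]
  rw [log_powDensity hm hpos (Real.exp_pos y), Real.log_exp, ← Real.exp_mul, mul_comm y]
  ring

/-! ### The two principal solutions -/

theorem eqOn_principal₁ {r : ℕ} :
    EqOn (powDensity (2 * r) fun s => Real.exp (-s)) (principal₁ r) (Ioi 0) := by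
  intro x _
  simp only [powDensity, principal₁]
  push_cast
  rfl

theorem eqOn_principal₂ {r : ℕ} (hr : 1 ≤ r) :
    EqOn (powDensity (2 * r) fun s => 4 * s * besselK₀ (2 * s)) (principal₂ r) (Ioi 0) := by
  intro x hx
  have hx0 : 0 < x := hx
  have hr0 : (0 : ℝ) < r := by exact_mod_cast hr
  have h1 : x ^ ((2 * r - 1 : ℝ) / (2 * r)) = x ^ ((r - 1 : ℝ) / r) * x ^ (1 / (2 * r : ℝ)) := by
    rw [← Real.rpow_add hx0]
    congr 1
    field_simp
    ring
  have h2 : 0 < x ^ ((r - 1 : ℝ) / r) := Real.rpow_pos_of_pos hx0 _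
  have h3 : 0 < x ^ (1 / (2 * r : ℝ)) := Real.rpow_pos_of_pos hx0 _
  simp only [powDensity, principal₂]
  push_cast
  rw [h1]
  field_simp
  ring

theorem integrableOn_pow_mul_exp_neg (k : ℕ) :
    IntegrableOn (fun s : ℝ => s ^ k * Real.exp (-s)) (Ioi 0) := by
  simpa using integrableOn_pow_mul_exp_neg_mul k one_pos

theorem integral_pow_mul_exp_neg (k : ℕ) :
    ∫ s in Ioi (0 : ℝ), s ^ k * Real.exp (-s) = k ! := by
  simpa using integral_pow_mul_exp_neg_mul k one_pos

theorem isStieltjesSolution_powDensity_exp {r : ℕ} (hr : 1 ≤ r) :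
    IsStieltjesSolution (moments₁ r) (powDensity (2 * r) fun s => Real.exp (-s)) :=
  isStieltjesSolution_powDensity (by omega) (by fun_prop) (fun s _ => Real.exp_pos _)
    (fun _ => integrableOn_pow_mul_exp_neg _) fun _ => integral_pow_mul_exp_neg _

theorem mul_besselK₀_pos {s : ℝ} (hs : 0 < s) : 0 < 4 * s * besselK₀ (2 * s) :=
  mul_pos (by positivity) (besselK₀_pos (by positivity))

theorem continuousOn_mul_besselK₀ :
    ContinuousOn (fun s => 4 * s * besselK₀ (2 * s)) (Ioi 0) :=
  ContinuousOn.mul (by fun_prop)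
    (continuousOn_besselK₀.comp (by fun_prop) fun s hs => mul_pos two_pos (mem_Ioi.1 hs))

theorem mul_exp_le_mul_besselK₀ {s : ℝ} (hs : 0 < s) :
    s ^ 1 * Real.exp (-(4 * s)) ≤ 4 * s * besselK₀ (2 * s) := by
  have h := exp_neg_two_mul_le_besselK₀ (mul_pos two_pos hs)
  rw [show 2 * (2 * s) = 4 * s by ring] at h
  rw [pow_one]
  exact mul_le_mul (by linarith) h (Real.exp_pos _).le (by positivity)

theorem integrableOn_pow_mul_mul_besselK₀ (r n : ℕ) :
    IntegrableOn (fun s => s ^ (2 * r * n) * (4 * s * besselK₀ (2 * s))) (Ioi 0) := by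
  rw [mul_assoc]
  exact integrableOn_pow_mul_besselK₀ (r * n)

theorem integral_pow_mul_mul_besselK₀ (r n : ℕ) :
    ∫ s in Ioi (0 : ℝ), s ^ (2 * r * n) * (4 * s * besselK₀ (2 * s)) = moments₂ r n := by
  rw [mul_assoc]
  exact integral_pow_mul_besselK₀ (r * n)

theorem isStieltjesSolution_powDensity_besselK₀ {r : ℕ} (hr : 1 ≤ r) :
    IsStieltjesSolution (moments₂ r) (powDensity (2 * r) fun s => 4 * s * besselK₀ (2 * s)) :=
  isStieltjesSolution_powDensity (by omega) continuousOn_mul_besselK₀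
    (fun _ => mul_besselK₀_pos) (integrableOn_pow_mul_mul_besselK₀ r)
    (integral_pow_mul_mul_besselK₀ r)

theorem isStieltjesSolution_principal₁ {r : ℕ} (hr : 1 ≤ r) :
    IsStieltjesSolution (moments₁ r) (principal₁ r) :=
  (isStieltjesSolution_powDensity_exp hr).congr eqOn_principal₁

theorem isStieltjesSolution_principal₂ {r : ℕ} (hr : 1 ≤ r) :
    IsStieltjesSolution (moments₂ r) (principal₂ r) :=
  (isStieltjesSolution_powDensity_besselK₀ hr).congr (eqOn_principal₂ hr)

theorem exists_isStieltjesSolution_ne_principal₁ {r : ℕ} (hr : 1 < r) :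
    ∃ V : ℝ → ℝ, IsStieltjesSolution (moments₁ r) V ∧ ∃ x : ℝ, 0 < x ∧ V x ≠ principal₁ r x := by
  obtain ⟨V, hV, x, hx, hne⟩ := exists_isStieltjesSolution_ne_powDensity (m := 2 * r) (by omega) 0
    one_pos (f := fun s => Real.exp (-s)) (ρ := moments₁ r) (by fun_prop) (fun s _ => by simp)
    (fun _ => integrableOn_pow_mul_exp_neg _) fun _ => integral_pow_mul_exp_neg _
  exact ⟨V, hV, x, hx, eqOn_principal₁ hx ▸ hne⟩

theorem exists_isStieltjesSolution_ne_principal₂ {r : ℕ} (hr : 1 < r) :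
    ∃ V : ℝ → ℝ, IsStieltjesSolution (moments₂ r) V ∧ ∃ x : ℝ, 0 < x ∧ V x ≠ principal₂ r x := by
  obtain ⟨V, hV, x, hx, hne⟩ := exists_isStieltjesSolution_ne_powDensity (m := 2 * r) (by omega) 1
    four_pos continuousOn_mul_besselK₀ (fun _ => mul_exp_le_mul_besselK₀)
    (integrableOn_pow_mul_mul_besselK₀ r) (integral_pow_mul_mul_besselK₀ r)
  exact ⟨V, hV, x, hx, eqOn_principal₂ hr.le hx ▸ hne⟩

theorem KreinIntegralConverges.congr {W V : ℝ → ℝ} (h : KreinIntegralConverges W)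
    (hWV : EqOn W V (Ioi 0)) : KreinIntegralConverges V := by
  refine (integrableOn_congr_fun (fun x hx => ?_) measurableSet_Ioi).1 h
  have hx2 : x ^ 2 ∈ Ioi (0 : ℝ) := pow_pos (mem_Ioi.1 hx) 2
  simp only [hWV hx2]

theorem kreinIntegralConverges_principal₁ {r : ℕ} (hr : 1 < r) :
    KreinIntegralConverges (principal₁ r) := by
  refine (kreinIntegralConverges_powDensity (by omega)
    (isStieltjesSolution_powDensity_exp hr.le).continuousOn (fun s _ => Real.exp_pos _)
    fun s hs => ?_).congr eqOn_principal₁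
  rw [Real.log_exp, abs_neg, abs_of_pos hs]
  linarith [abs_nonneg (Real.log s)]

theorem abs_log_mul_besselK₀_le {s : ℝ} (hs : 0 < s) :
    |Real.log (4 * s * besselK₀ (2 * s))| ≤ 3 + |Real.log s| + 4 * s := by
  have h1 : 4 * s * besselK₀ (2 * s) ≤ 4 := by
    calc 4 * s * besselK₀ (2 * s) ≤ 4 * s * (2 / (2 * s)) :=
          mul_le_mul_of_nonneg_left (besselK₀_le (by positivity)) (by positivity)
      _ = 4 := by field_simp
  have h2 : Real.log (4 * s * besselK₀ (2 * s)) ≤ 3 :=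
    (Real.log_le_sub_one_of_pos (mul_besselK₀_pos hs)).trans (by linarith)
  have h3 := Real.log_le_log (by positivity) (mul_exp_le_mul_besselK₀ hs)
  rw [pow_one, Real.log_mul hs.ne' (Real.exp_pos _).ne', Real.log_exp] at h3
  rw [abs_le]
  constructor <;> linarith [neg_abs_le (Real.log s), abs_nonneg (Real.log s)]

theorem kreinIntegralConverges_principal₂ {r : ℕ} (hr : 1 < r) :
    KreinIntegralConverges (principal₂ r) :=
  (kreinIntegralConverges_powDensity (by omega)
    (isStieltjesSolution_powDensity_besselK₀ hr.le).continuousOn (fun _ => mul_besselK₀_pos)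
    fun _ => abs_log_mul_besselK₀_le).congr (eqOn_principal₂ hr.le)

theorem convexOn_neg_log_principal₁ {r : ℕ} (hr : 1 ≤ r) :
    ConvexOn ℝ univ fun y => -Real.log (principal₁ r (Real.exp y)) := by
  refine (convexOn_neg_log_powDensity_exp (m := 2 * r) (f := fun s => Real.exp (-s)) (by omega)
    (fun s _ => Real.exp_pos _) ?_).congr fun y _ => ?_
  · simp only [Real.log_exp, neg_neg]
    refine ⟨convex_univ, fun x _ y _ a b ha hb hab => ?_⟩
    have h := convexOn_exp.2 (mem_univ (1 / ((2 * r : ℕ) : ℝ) * x))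
      (mem_univ (1 / ((2 * r : ℕ) : ℝ) * y)) ha hb hab
    refine le_trans (le_of_eq ?_) h
    simp only [smul_eq_mul]
    congr 1
    ring
  · simp only [eqOn_principal₁ (show Real.exp y ∈ Ioi (0 : ℝ) from Real.exp_pos y)]

theorem convexOn_neg_log_principal₂ {r : ℕ} (hr : 1 ≤ r) :
    ConvexOn ℝ univ fun y => -Real.log (principal₂ r (Real.exp y)) := by
  have ha : 0 < 1 / ((2 * r : ℕ) : ℝ) := one_div_pos.2 (by exact_mod_cast (by omega : 0 < 2 * r))
  refine (convexOn_neg_log_powDensity_exp (m := 2 * r) (f := fun s => 4 * s * besselK₀ (2 * s))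
    (by omega) (fun _ => mul_besselK₀_pos) ?_).congr fun y _ => ?_
  · refine ((convexOn_const_add_mul (-Real.log 4) (-(1 / ((2 * r : ℕ) : ℝ)))).add
      (convexOn_neg_log_besselK₀_exp ha)).congr fun y _ => ?_
    have hK := besselK₀_pos (mul_pos two_pos (Real.exp_pos (1 / ((2 * r : ℕ) : ℝ) * y)))
    simp only [Pi.add_apply]
    rw [Real.log_mul (by positivity) hK.ne', Real.log_mul four_ne_zero (Real.exp_pos _).ne',
      Real.log_exp]
    ring
  · simp only [eqOn_principal₂ hr (show Real.exp y ∈ Ioi (0 : ℝ) from Real.exp_pos y)]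

theorem mainTheorem3 :
    -- the functions `principal₁ r`, `principal₂ r` solve the two moment problems
    (∀ r : ℕ, 1 ≤ r →
      IsStieltjesSolution (moments₁ r) (principal₁ r) ∧
      IsStieltjesSolution (moments₂ r) (principal₂ r)) ∧
    -- `r = 1`: divergence of the Carleman series, and uniqueness
    (¬ Summable (carlemanTerm (moments₁ 1)) ∧
      StieltjesDeterminate (moments₁ 1) ∧
      (∀ W : ℝ → ℝ, IsStieltjesSolution (moments₁ 1) W → EqOn W (principal₁ 1) (Ioi 0)) ∧
      ¬ Summable (carlemanTerm (moments₂ 1)) ∧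
      StieltjesDeterminate (moments₂ 1) ∧
      (∀ W : ℝ → ℝ, IsStieltjesSolution (moments₂ 1) W → EqOn W (principal₂ 1) (Ioi 0))) ∧
    -- `r > 1`: convergence of the Carleman series and of the Krein integral, convexity of
    -- `y ↦ -ln W(eʸ)`, and non-uniqueness, for each of the two problems
    (∀ r : ℕ, 1 < r →
      (Summable (carlemanTerm (moments₁ r)) ∧
        KreinIntegralConverges (principal₁ r) ∧
        ConvexOn ℝ univ (fun y : ℝ => -Real.log (principal₁ r (Real.exp y))) ∧
        StieltjesIndeterminate (moments₁ r) ∧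
        (∃ W : ℝ → ℝ, IsStieltjesSolution (moments₁ r) W ∧
          ∃ x : ℝ, 0 < x ∧ W x ≠ principal₁ r x)) ∧
      (Summable (carlemanTerm (moments₂ r)) ∧
        KreinIntegralConverges (principal₂ r) ∧
        ConvexOn ℝ univ (fun y : ℝ => -Real.log (principal₂ r (Real.exp y))) ∧
        StieltjesIndeterminate (moments₂ r) ∧
        (∃ W : ℝ → ℝ, IsStieltjesSolution (moments₂ r) W ∧
          ∃ x : ℝ, 0 < x ∧ W x ≠ principal₂ r x))) := by
  have hle₁ : ∀ n, moments₁ 1 n ≤ ((2 * n)! : ℕ) := fun n => le_of_eq (by simp [moments₁])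
  have hle₂ : ∀ n, moments₂ 1 n ≤ ((2 * n)! : ℕ) := fun n =>
    (moments₂_le_moments₁ 1 n).trans (hle₁ n)
  have hpos₂ : ∀ n, 0 < moments₂ 1 n := fun n => by
    rw [moments₂]
    positivity
  have hpos₁ : ∀ n, 0 < moments₁ 1 n := fun n => (hpos₂ n).trans_le (moments₂_le_moments₁ 1 n)
  have hW₁ := isStieltjesSolution_principal₁ le_rfl
  have hW₂ := isStieltjesSolution_principal₂ le_rfl
  refine ⟨fun r hr => ⟨isStieltjesSolution_principal₁ hr, isStieltjesSolution_principal₂ hr⟩,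
    ⟨not_summable_carlemanTerm hpos₁ hle₁, hW₁.determinate_of_le_factorial hle₁,
      fun W hW => hW.eqOn_of_le_factorial hW₁ hle₁,
      not_summable_carlemanTerm hpos₂ hle₂, hW₂.determinate_of_le_factorial hle₂,
      fun W hW => hW.eqOn_of_le_factorial hW₂ hle₂⟩, fun r hr => ⟨?_, ?_⟩⟩
  · obtain ⟨V, hV, hne⟩ := exists_isStieltjesSolution_ne_principal₁ hr
    exact ⟨summable_carlemanTerm fun n =>
        (sq_factorial_le_moments₂ hr n).trans (moments₂_le_moments₁ r n),
      kreinIntegralConverges_principal₁ hr, convexOn_neg_log_principal₁ hr.le,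
      (isStieltjesSolution_principal₁ hr.le).indeterminate hV hne, V, hV, hne⟩
  · obtain ⟨V, hV, hne⟩ := exists_isStieltjesSolution_ne_principal₂ hr
    exact ⟨summable_carlemanTerm (sq_factorial_le_moments₂ hr),
      kreinIntegralConverges_principal₂ hr, convexOn_neg_log_principal₂ hr.le,
      (isStieltjesSolution_principal₂ hr.le).indeterminate hV hne, V, hV, hne⟩
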